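/- A continuous map $f:X\to Y$ between finite $T_0$-spaces is called distinguished if for every $y\in Y$ the preimage $f^{-1}(U_y)$ is contractible, where $U_y$ is the intersection of all open subsets of $Y$ containing $y$. Let $\mathcal{D}$ be the class of distinguished maps and let $\overline{\mathcal{D}}$ be the smallest class of continuous maps between finite $T_0$-spaces that contains $\mathcal{D}$ and has the 2-of-3 property up to homotopy: whenever $fg\simeq h$ and two of the maps $f,g,h$ belong to the class, so does the third. For a finite simplicial complex $K$, let $|K|$ be its geometric realization and let $\mathcal{X}(K)$ be the finite $T_0$-space whose points are the (non-empty) simplices of $K$ and whose open sets are the sets of simplices closed under passing to faces. A simplicial map $\varphi:K\to L$ induces the continuous maps $|\varphi|:|K|\to|L|$ and $\mathcal{X}(\varphi):\mathcal{X}(K)\to\mathcal{X}(L)$, $S\mapsto\varphi(S)$. Theorem. Let $n\ge 0$, let $K_0,K_1,\ldots,K_n$ be finite simplicial complexes and let $f_i:|K_i|\to|K_{i+1}|$ $(0\le i<n)$ be continuous maps such that for each $0\le i<n$ one of the following holds: (1) $f_i=|\varphi_i|$, where $\varphi_i:K_i\to K_{i+1}$ is a simplicial map such that $\mathcal{X}(\varphi_i)\in\overline{\mathcal{D}}$;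 (2) $f_i$ is a homotopy inverse of $|\varphi_i|$, where $\varphi_i:K_{i+1}\to K_i$ is a simplicial map such that $\mathcal{X}(\varphi_i)\in\overline{\mathcal{D}}$. Let $\varphi:K_0\to K_n$ be a simplicial map such that $|\varphi|\simeq f_{n-1}f_{n-2}\cdots f_0$ (the identity of $|K_0|$ if $n=0$). Then $\mathcal{X}(\varphi)\in\overline{\mathcal{D}}$. -/

import Mathlib

universe u

/-! ### Finite T₀-spaces and the class generated by the distinguished maps -/

/-- A finite `T₀`-space. -/
structure FinT0Space : Type (u + 1) where
  carrier : Type u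
  [top : TopologicalSpace carrier]
  [fin : Finite carrier]
  [t0 : T0Space carrier]

namespace FinT0Space

instance : CoeSort FinT0Space.{u} (Type u) := ⟨FinT0Space.carrier⟩

attribute [instance] FinT0Space.top FinT0Space.fin FinT0Space.t0

end FinT0Space

/-- A class of continuous maps between finite `T₀`-spaces. -/
abbrev MapClass : Type (u + 1) := ∀ ⦃X Y : FinT0Space.{u}⦄, C(X, Y) → Prop

/-- The minimal open set `U_y`: the intersection of all open sets containing `y`. -/
def minOpen {X : Type*} [TopologicalSpace X] (y : X) : Set X :=
  ⋂₀ {U : Set X | IsOpen U ∧ y ∈ U}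

/-- The class `𝒟` of distinguished maps: `f⁻¹(U_y)` is contractible for every point `y` of the
target. -/
def Distinguished : MapClass.{u} := fun _ Y f =>
  ∀ y : Y, ContractibleSpace (f ⁻¹' minOpen y)

/-- The class generated by `𝒞`: the smallest class of maps between finite `T₀`-spaces which
contains `𝒞` and has the 2-of-3 property up to homotopy, i.e. whenever `f g ≃ h` and two of the
three maps `f`, `g`, `h` are in the class, so is the third one. -/
inductive Generated (C : MapClass.{u}) : MapClass.{u}
  | basic {X Y : FinT0Space.{u}} {f : C(X, Y)} (hf : C f) : Generated C f
  | comp {X Y Z : FinT0Space.{u}} {f : C(Y, Z)} {g : C(X, Y)} {h : C(X, Z)}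
      (e : (f.comp g).Homotopic h) (hf : Generated C f) (hg : Generated C g) : Generated C h
  | left {X Y Z : FinT0Space.{u}} {f : C(Y, Z)} {g : C(X, Y)} {h : C(X, Z)}
      (e : (f.comp g).Homotopic h) (hg : Generated C g) (hh : Generated C h) : Generated C f
  | right {X Y Z : FinT0Space.{u}} {f : C(Y, Z)} {g : C(X, Y)} {h : C(X, Z)}
      (e : (f.comp g).Homotopic h) (hf : Generated C f) (hh : Generated C h) : Generated C g

/-- The class `𝒟̄` generated by the distinguished maps. -/
def DBar : MapClass.{u} := Generated Distinguished

/-! ### Finite simplicial complexes and simplicial maps -/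

/-- A finite simplicial complex: a finite set of vertices with a set of nonempty finite subsets,
the simplices, which contains all singletons and all nonempty subsets of its members. -/
structure FinSimplicialComplex : Type (u + 1) where
  Vertex : Type u
  [fintypeVertex : Fintype Vertex]
  toComplex : AbstractSimplicialComplex Vertex

namespace FinSimplicialComplex

attribute [instance] FinSimplicialComplex.fintypeVertex

/-- The type of simplices of `K`; it is ordered by inclusion. -/
abbrev Simplex (K : FinSimplicialComplex.{u}) : Type u :=
  {s : Finset K.Vertex // s ∈ K.toComplex}

/-- The geometric realization `|K|`: the points of the standard simplex on the vertices of `K`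
(with the Euclidean topology) whose support is contained in a simplex of `K`. -/
abbrev Realization (K : FinSimplicialComplex.{u}) : Type u :=
  {x : stdSimplex ℝ K.Vertex // ∃ s ∈ K.toComplex, ∀ v, x v ≠ 0 → v ∈ s}

/-- The finite space `𝒳(K)`: the poset of simplices of `K`, ordered by inclusion, with the topology
whose open sets are the lower sets (so that `U_S` is the set of all simplices contained in `S`). -/
def faceSpace (K : FinSimplicialComplex.{u}) : FinT0Space.{u} where
  carrier := Topology.WithLowerSet K.Simplex
  fin := inferInstanceAs (Finite K.Simplex)
  t0 := ⟨fun _ _ h => le_antisymm (α := K.Simplex)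
    (Topology.WithLowerSet.ofLowerSet_le_ofLowerSet.2 h.specializes)
    (Topology.WithLowerSet.ofLowerSet_le_ofLowerSet.2 h.symm.specializes)⟩

end FinSimplicialComplex

open Classical in
/-- A simplicial map: a map on vertices which sends simplices to simplices. -/
structure SimplicialMap (K L : FinSimplicialComplex.{u}) where
  toFun : K.Vertex → L.Vertex
  image_mem : ∀ s ∈ K.toComplex, s.image toFun ∈ L.toComplex

namespace SimplicialMap

variable {K L : FinSimplicialComplex.{u}}

theorem map_support (φ : SimplicialMap K L) (x : K.Realization) :
    ∃ t ∈ L.toComplex, ∀ w, stdSimplex.map φ.toFun x.1 w ≠ 0 → w ∈ t := by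
  classical
  obtain ⟨s, hs, hx⟩ := x.2
  refine ⟨s.image φ.toFun, by convert φ.image_mem s hs, fun w hw => ?_⟩
  rw [stdSimplex.map_coe, FunOnFinite.linearMap_apply_apply] at hw
  obtain ⟨v, hv, hne⟩ := Finset.exists_ne_zero_of_sum_ne_zero hw
  rw [Finset.mem_filter] at hv
  exact Finset.mem_image.2 ⟨v, hx v hne, hv.2⟩

/-- The map `|φ| : |K| → |L|` which extends `φ` linearly on each simplex. -/
noncomputable def realization (φ : SimplicialMap K L) : C(K.Realization, L.Realization) where
  toFun x := ⟨stdSimplex.map φ.toFun x.1, φ.map_support x⟩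
  continuous_toFun :=
    ((stdSimplex.continuous_map φ.toFun).comp continuous_subtype_val).subtype_mk _

open Classical in
/-- The map `𝒳(φ) : 𝒳(K) → 𝒳(L)`, `S ↦ φ(S)`. -/
noncomputable def faceMap (φ : SimplicialMap K L) : C(K.faceSpace, L.faceSpace) :=
  Topology.WithLowerSet.map (α := K.Simplex) (β := L.Simplex)
    { toFun := fun s => ⟨s.1.image φ.toFun, φ.image_mem s.1 s.2⟩
      monotone' := fun _ _ h => Finset.image_subset_image h }

end SimplicialMap

/-! ### Homotopy inverses and composites of finite sequences of maps -/

/-- `f` and `g` are homotopy inverse to each other. -/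
def IsHomotopyInverse {X Y : Type*} [TopologicalSpace X] [TopologicalSpace Y]
    (f : C(X, Y)) (g : C(Y, X)) : Prop :=
  (f.comp g).Homotopic (ContinuousMap.id Y) ∧ (g.comp f).Homotopic (ContinuousMap.id X)

/-- The composite `f_{n-1} ⋯ f_1 f_0 : X_0 → X_n` of maps `f_i : X_i → X_{i+1}`, `0 ≤ i < n`
(the identity if `n = 0`). -/
def chainComp : ∀ (n : ℕ) (X : Fin (n + 1) → Type u) [∀ i, TopologicalSpace (X i)],
    (∀ i : Fin n, C(X i.castSucc, X i.succ)) → C(X 0, X (Fin.last n))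
  | 0, _, _, _ => ContinuousMap.id _
  | n + 1, X, _, f =>
      (f (Fin.last n)).comp
        (chainComp n (fun i : Fin (n + 1) => X i.castSucc) (fun i : Fin n => f i.castSucc))

/-!
Two simplicial approximations of the same continuous map are contiguous, so they induce homotopic
maps of face spaces. An approximation `ψ : K⁽ⁿ⁾ → L` is refined to `K⁽ⁿ⁺¹⁾` by composing it with a
simplicial map `K⁽ⁿ⁺¹⁾ → K⁽ⁿ⁾` sending each simplex of `K⁽ⁿ⁾` to one of its vertices. The induced
map of face spaces is homotopic to the map sending a chain of simplices to its largest element,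
which is distinguished; hence refining does not change whether `𝒳(ψ)` lies in `𝒟̄`. So, for a
continuous map `f : |K| → |L|`, whether the approximations of `f` lie in `𝒟̄` depends on `f` alone.
As maps that are close to each other have a common approximation, this property of `f` is locally
constant on the space of maps, and therefore invariant under homotopy.

By the 2-of-3 property it passes from `f` to `|φ| f` when `𝒳(φ) ∈ 𝒟̄`, and also back from `|φ| f` to
`f`. If `g` is a homotopy inverse of `|φ|`, then `|φ| g f ≃ f`, so the property passes from `f` to
`g f` as well. The identity has it, because it is approximated by the map `K' → K` above, and thus
so does the composite of the given chain; `φ` is an approximation of `|φ|`.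
-/

/-! ### Finite spaces and generated classes of maps -/

section Specialization

variable {X Y : Type*} [TopologicalSpace X] [TopologicalSpace Y]

theorem homotopic_of_specializes (f g : C(X, Y)) (h : ∀ x, f x ⤳ g x) : f.Homotopic g := by
  classical
  -- The homotopy is `f` at all times before `1`, and `g` at time `1`.
  let s : Set (unitInterval × X) := {p | p.1 ≠ 1}
  have hs : IsOpen s := isOpen_ne_fun continuous_fst continuous_const
  exact ⟨{
    toFun := s.piecewise (fun p => f p.2) (fun p => g p.2)
    continuous_toFun := hs.continuous_piecewise_of_specializes
      (f.continuous.comp continuous_snd) (g.continuous.comp continuous_snd) fun p => h p.2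
    map_zero_left := fun x => Set.piecewise_eq_of_mem _ _ _ zero_ne_one
    map_one_left := fun x => Set.piecewise_eq_of_notMem _ _ _ (not_not_intro rfl) }⟩

theorem contractibleSpace_of_specializes (g : C(X, X)) (a : X) (hg : ∀ x, x ⤳ g x)
    (ha : ∀ x, a ⤳ g x) : ContractibleSpace X :=
  (contractible_iff_id_nullhomotopic X).2 ⟨a,
    (homotopic_of_specializes (.id X) g hg).trans
      (homotopic_of_specializes (.const X a) g ha).symm⟩

theorem continuous_of_specializes_map [AlexandrovDiscrete X] {f : X → Y}
    (h : ∀ x y, x ⤳ y → f x ⤳ f y) : Continuous f :=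
  continuous_def.2 fun _ hU => isOpen_iff_forall_specializes.2 fun x y hxy hy =>
    (h x y hxy).mem_open hU hy

theorem mem_minOpen {x y : X} : x ∈ minOpen y ↔ x ⤳ y := by
  simp only [minOpen, Set.mem_sInter, Set.mem_ofPred_eq, and_imp, specializes_iff_forall_open]

theorem eq_of_homotopic_of_isLocallyConstant {α : Type*} {P : C(X, Y) → α}
    (hP : IsLocallyConstant P) {f g : C(X, Y)} (h : f.Homotopic g) : P f = P g := by
  obtain ⟨H⟩ := h
  simpa only [Function.comp_apply, H.curry_zero, H.curry_one] using
    (hP.comp_continuous H.curry.continuous).apply_eq_of_preconnectedSpace 0 1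

end Specialization

section LowerSet

open Topology.WithLowerSet (toLowerSet toLowerSet_specializes_toLowerSet)

variable {α β : Type*} [Preorder α] [Preorder β]

theorem lowerSetMap_homotopic_of_le {f g : α →o β} (h : f ≤ g) :
    (Topology.WithLowerSet.map f).Homotopic (Topology.WithLowerSet.map g) :=
  homotopic_of_specializes _ _ fun a => toLowerSet_specializes_toLowerSet.2 (h a)

theorem contractibleSpace_lowerSetMap_preimage_minOpen (f : α →o β) {b : β}
    (g : {x // f x ≤ b} →o {x // f x ≤ b}) (a : {x // f x ≤ b}) (hg : ∀ x, x ≤ g x)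
    (ha : ∀ x, a ≤ g x) :
    ContractibleSpace (Topology.WithLowerSet.map f ⁻¹' minOpen (toLowerSet b)) := by
  let F : Set (Topology.WithLowerSet α) := Topology.WithLowerSet.map f ⁻¹' minOpen (toLowerSet b)
  let e : F ≃ {x // f x ≤ b} :=
    Equiv.subtypeEquiv Topology.WithLowerSet.ofLowerSet fun _ =>
      mem_minOpen.trans toLowerSet_specializes_toLowerSet
  have specializes_iff (x y : F) : x ⤳ y ↔ e x ≤ e y :=
    (subtype_specializes_iff x y).trans toLowerSet_specializes_toLowerSet
  let G : C(F, F) := ⟨fun x => e.symm (g (e x)), continuous_of_specializes_map fun x y hxy => by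
    simpa only [specializes_iff, e.apply_symm_apply] using g.monotone ((specializes_iff x y).1 hxy)⟩
  refine contractibleSpace_of_specializes G (e.symm a) (fun x => ?_) fun x => ?_
  · simpa only [specializes_iff, G, ContinuousMap.coe_mk, e.apply_symm_apply] using hg (e x)
  · simpa only [specializes_iff, G, ContinuousMap.coe_mk, e.apply_symm_apply] using ha (e x)

end LowerSet

namespace Generated

variable {C : MapClass.{u}} {X Y Z : FinT0Space.{u}}

theorem id_source {f : C(X, Y)} (hf : Generated C f) : Generated C (ContinuousMap.id X) :=
  .right (f := f) (.refl f) hf hf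

theorem of_homotopic {f g : C(X, Y)} (hf : Generated C f) (h : f.Homotopic g) : Generated C g :=
  .comp (g := .id X) h hf hf.id_source

theorem comp_iff_left {f : C(Y, Z)} {g : C(X, Y)} (hg : Generated C g) :
    Generated C (f.comp g) ↔ Generated C f :=
  ⟨.left (.refl _) hg, fun hf => .comp (.refl _) hf hg⟩

theorem comp_iff_right {f : C(Y, Z)} {g : C(X, Y)} (hf : Generated C f) :
    Generated C (f.comp g) ↔ Generated C g :=
  ⟨.right (.refl _) hf, fun hg => .comp (.refl _) hf hg⟩

end Generated

/-! ### Simplicial maps and barycentric subdivision -/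

namespace FinSimplicialComplex

variable {K : FinSimplicialComplex.{u}}

theorem nonempty_of_mem {s : Finset K.Vertex} (hs : s ∈ K.toComplex) : s.Nonempty :=
  (K.toComplex.isRelLowerSet_faces hs).1

theorem mem_of_subset {s t : Finset K.Vertex} (hs : s ∈ K.toComplex) (h : t ⊆ s)
    (ht : t.Nonempty) : t ∈ K.toComplex :=
  (K.toComplex.isRelLowerSet_faces hs).2 h ht

end FinSimplicialComplex

namespace SimplicialMap

variable {K L M : FinSimplicialComplex.{u}}

/-- The composite of two simplicial maps. -/
def comp (ψ : SimplicialMap L M) (φ : SimplicialMap K L) : SimplicialMap K M where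
  toFun := ψ.toFun ∘ φ.toFun
  image_mem s hs := by
    classical
    rw [← Finset.image_image]
    exact ψ.image_mem _ (φ.image_mem s hs)

theorem faceMap_comp (ψ : SimplicialMap L M) (φ : SimplicialMap K L) :
    (ψ.comp φ).faceMap = ψ.faceMap.comp φ.faceMap := by
  classical
  refine ContinuousMap.ext fun (s : K.Simplex) => ?_
  exact Subtype.ext (Finset.image_image (s := s.1) (f := φ.toFun) (g := ψ.toFun)).symm

open Classical in
/-- Two simplicial maps are contiguous if the images of every simplex under them are faces of a
common simplex; here the union of the images is itself required to be a simplex. -/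
def Contiguous (φ ψ : SimplicialMap K L) : Prop :=
  ∀ s ∈ K.toComplex, s.image φ.toFun ∪ s.image ψ.toFun ∈ L.toComplex

theorem Contiguous.faceMap_homotopic {φ ψ : SimplicialMap K L} (h : φ.Contiguous ψ) :
    φ.faceMap.Homotopic ψ.faceMap := by
  classical
  let joint : K.Simplex →o L.Simplex :=
    { toFun s := ⟨s.1.image φ.toFun ∪ s.1.image ψ.toFun, h s.1 s.2⟩
      monotone' _ _ hst := Finset.union_subset_union (Finset.image_subset_image hst)
        (Finset.image_subset_image hst) }
  exact (lowerSetMap_homotopic_of_le (g := joint) fun _ => Finset.subset_union_left).trans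
    (lowerSetMap_homotopic_of_le (g := joint) fun _ => Finset.subset_union_right).symm

theorem dbar_comp_iff_left {ψ : SimplicialMap L M} {φ : SimplicialMap K L}
    (hφ : DBar φ.faceMap) : DBar (ψ.comp φ).faceMap ↔ DBar ψ.faceMap := by
  rw [faceMap_comp]
  exact Generated.comp_iff_left hφ

theorem dbar_comp_iff_right {ψ : SimplicialMap L M} {φ : SimplicialMap K L}
    (hψ : DBar ψ.faceMap) : DBar (ψ.comp φ).faceMap ↔ DBar φ.faceMap := by
  rw [faceMap_comp]
  exact Generated.comp_iff_right hψ

end SimplicialMap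

namespace FinSimplicialComplex

variable (K : FinSimplicialComplex.{u})

noncomputable instance : Fintype K.Simplex := Fintype.ofFinite _

/-- The barycentric subdivision: its simplices are the nonempty chains of simplices of `K`. -/
noncomputable abbrev subdivision : FinSimplicialComplex.{u} where
  Vertex := K.Simplex
  toComplex :=
    { faces := {c | c.Nonempty ∧ IsChain (· ≤ ·) (c : Set K.Simplex)}
      isRelLowerSet_faces := fun _ hc =>
        ⟨hc.1, fun _ h ht => ⟨ht, hc.2.mono (Finset.coe_subset.2 h)⟩⟩
      singleton_mem := fun v => by simp }

variable {K} in
theorem exists_max_of_mem_subdivision {c : Finset K.Simplex} (hc : c ∈ K.subdivision.toComplex) :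
    ∃ s ∈ c, ∀ t ∈ c, t ≤ s := by
  obtain ⟨s, hs⟩ := c.exists_maximal hc.1
  exact ⟨s, hs.1, fun t ht => (hc.2.total ht hs.1).elim id (hs.2 ht)⟩

open Classical in
/-- The map which sends a chain of simplices to its largest element, encoded as the union of the
chain. -/
noncomputable def chainMax : K.subdivision.Simplex →o K.Simplex where
  toFun c := ⟨c.1.sup Subtype.val, by
    obtain ⟨s, hs, h⟩ := exists_max_of_mem_subdivision c.2
    rw [le_antisymm (Finset.sup_le h) (Finset.le_sup hs)]
    exact s.2⟩
  monotone' _ _ h := Finset.sup_mono (f := (Subtype.val : K.Simplex → Finset K.Vertex)) h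

variable {K} in
theorem chainMax_le_iff {c : K.subdivision.Simplex} {s : K.Simplex} :
    K.chainMax c ≤ s ↔ ∀ t ∈ c.1, t ≤ s := by
  classical
  exact Finset.sup_le_iff (f := (Subtype.val : K.Simplex → Finset K.Vertex))

/-- The continuous map `𝒳(K') → 𝒳(K)` induced by `chainMax`. -/
noncomputable def maxMap : C(K.subdivision.faceSpace, K.faceSpace) :=
  Topology.WithLowerSet.map (α := K.subdivision.Simplex) (β := K.Simplex) K.chainMax

theorem distinguished_maxMap : Distinguished K.maxMap := by
  classical
  -- The chains below `s` are contracted by `c ≤ c ∪ {s} ≥ {s}`.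
  intro (s : K.Simplex)
  have insert_mem (c : {c // K.chainMax c ≤ s}) : insert s c.1.1 ∈ K.subdivision.toComplex := by
    refine ⟨Finset.insert_nonempty _ _, ?_⟩
    rw [Finset.coe_insert]
    exact c.1.2.2.insert fun t ht _ => .inr (chainMax_le_iff.1 c.2 t ht)
  let insertTop : {c // K.chainMax c ≤ s} →o {c // K.chainMax c ≤ s} :=
    { toFun c := ⟨⟨insert s c.1.1, insert_mem c⟩, chainMax_le_iff.2 <|
        Finset.forall_mem_insert _ _ _ |>.2 ⟨le_rfl, chainMax_le_iff.1 c.2⟩⟩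
      monotone' _ _ h := Finset.insert_subset_insert s h }
  let top : {c // K.chainMax c ≤ s} := ⟨⟨{s}, K.subdivision.toComplex.singleton_mem s⟩,
    chainMax_le_iff.2 fun _ ht => (Finset.mem_singleton.1 ht).le⟩
  exact contractibleSpace_lowerSetMap_preimage_minOpen K.chainMax insertTop top
    (fun c => Finset.subset_insert s c.1.1)
    fun c => Finset.singleton_subset_iff.2 (Finset.mem_insert_self s c.1.1)

/-- A simplicial map `K' → K` which sends each simplex to one of its vertices. The choice of the
vertices is immaterial: any two such maps are contiguous. -/
noncomputable def vertexMap : SimplicialMap K.subdivision K where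
  toFun s := (nonempty_of_mem s.2).choose
  image_mem c hc := by
    classical
    refine mem_of_subset (K.chainMax ⟨c, hc⟩).2 (Finset.image_subset_iff.2 fun s hs => ?_)
      (hc.1.image _)
    exact chainMax_le_iff.1 le_rfl s hs (nonempty_of_mem s.2).choose_spec

variable {K} in
theorem vertexMap_mem (s : K.Simplex) : K.vertexMap.toFun s ∈ s.1 :=
  (nonempty_of_mem s.2).choose_spec

theorem dbar_vertexMap : DBar K.vertexMap.faceMap := by
  classical
  have maxMap_homotopic : K.maxMap.Homotopic K.vertexMap.faceMap :=
    (lowerSetMap_homotopic_of_le fun _ => Finset.image_subset_iff.2 fun s hs =>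
      chainMax_le_iff.1 le_rfl s hs (vertexMap_mem s)).symm
  exact .of_homotopic (.basic K.distinguished_maxMap) maxMap_homotopic

/-! ### The geometric realization -/

variable {K}

/-- The open star of a vertex. -/
def openStar (v : K.Vertex) : Set K.Realization := {x | 0 < x.1 v}

theorem mem_openStar_iff_ne_zero {x : K.Realization} {v : K.Vertex} :
    x ∈ openStar v ↔ x.1 v ≠ 0 :=
  (stdSimplex.zero_le x.1 v).lt_iff_ne'

theorem continuous_coord (v : K.Vertex) : Continuous fun x : K.Realization => x.1 v :=
  (continuous_apply v).comp (continuous_subtype_val.comp continuous_subtype_val)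

theorem isOpen_openStar (v : K.Vertex) : IsOpen (openStar v) :=
  isOpen_lt continuous_const (continuous_coord v)

theorem exists_mem_openStar (x : K.Realization) : ∃ v, x ∈ openStar v := by
  by_contra! h
  have sum_nonpos : ∑ v, x.1 v ≤ 0 := Finset.sum_nonpos fun v _ => not_lt.1 (h v)
  exact one_pos.not_ge (stdSimplex.sum_eq_one x.1 ▸ sum_nonpos)

theorem exists_carrier (x : K.Realization) :
    ∃ s ∈ K.toComplex, ∀ v, x ∈ openStar v → v ∈ s := by
  simpa only [mem_openStar_iff_ne_zero] using x.2

theorem mem_of_forall_mem_openStar (x : K.Realization) {t : Finset K.Vertex} (ht : t.Nonempty)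
    (h : ∀ v ∈ t, x ∈ openStar v) : t ∈ K.toComplex := by
  obtain ⟨s, hs, hx⟩ := exists_carrier x
  exact mem_of_subset hs (fun v hv => hx v (h v hv)) ht

instance : CompactSpace K.Realization := by
  suffices IsClosed {x : stdSimplex ℝ K.Vertex | ∃ s ∈ K.toComplex, ∀ v, x v ≠ 0 → v ∈ s} from
    isCompact_iff_compactSpace.1 this.isCompact
  have realization_eq : {x : stdSimplex ℝ K.Vertex | ∃ s ∈ K.toComplex, ∀ v, x v ≠ 0 → v ∈ s} =
      ⋃ s ∈ {s | s ∈ K.toComplex}, ⋂ v ∈ {v | v ∉ s}, {x : stdSimplex ℝ K.Vertex | x v = 0} := by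
    ext x
    simp only [Set.mem_ofPred_eq, Set.mem_iUnion, Set.mem_iInter, exists_prop, not_imp_comm]
  rw [realization_eq]
  exact (Set.toFinite _).isClosed_biUnion fun s _ => isClosed_biInter fun v _ =>
    isClosed_eq ((continuous_apply v).comp continuous_subtype_val) continuous_const

open Classical in
/-- The barycenter of a simplex. -/
noncomputable def barycenter (s : K.Simplex) : K.Realization :=
  ⟨⟨fun v => if v ∈ s.1 then (s.1.card : ℝ)⁻¹ else 0, fun v => by positivity, by
    have card_ne_zero : (s.1.card : ℝ) ≠ 0 := by exact_mod_cast (nonempty_of_mem s.2).card_ne_zero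
    rw [Finset.sum_ite_mem, Finset.univ_inter, Finset.sum_const, nsmul_eq_mul,
      mul_inv_cancel₀ card_ne_zero]⟩,
    s.1, s.2, fun _ => not_imp_comm.1 fun hv => if_neg hv⟩

open Classical in
theorem barycenter_apply (s : K.Simplex) (v : K.Vertex) :
    (barycenter s).1 v = if v ∈ s.1 then (s.1.card : ℝ)⁻¹ else 0 := rfl

theorem barycenter_mem_openStar_iff {s : K.Simplex} {v : K.Vertex} :
    barycenter s ∈ openStar v ↔ v ∈ s.1 := by
  classical
  have card_inv_ne_zero : (s.1.card : ℝ)⁻¹ ≠ 0 :=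
    inv_ne_zero (Nat.cast_ne_zero.2 (nonempty_of_mem s.2).card_ne_zero)
  rw [mem_openStar_iff_ne_zero, barycenter_apply, ne_eq, ite_eq_right_iff, not_forall,
    exists_prop, and_iff_left card_inv_ne_zero]

section LinearExtension

variable {E : Type*} [AddCommGroup E] [Module ℝ E]

/-- The value at `x` of the map `|K| → E` which is linear on each simplex and sends each vertex
`v` to `p v`. -/
def linearExtension (p : K.Vertex → E) (x : K.Realization) : E := ∑ v, x.1 v • p v

theorem linearExtension_mem {p : K.Vertex → E} {x : K.Realization} {A : Set E}
    (hA : Convex ℝ A) (h : ∀ v, x ∈ openStar v → p v ∈ A) : linearExtension p x ∈ A := by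
  rw [linearExtension, ← finsum_eq_sum_of_fintype]
  refine hA.finsum_mem (fun v => stdSimplex.zero_le x.1 v) ?_
    fun v hv => h v (mem_openStar_iff_ne_zero.2 hv)
  rw [finsum_eq_sum_of_fintype, stdSimplex.sum_eq_one]

theorem linearExtension_barycenter (p : K.Vertex → E) (s : K.Simplex) :
    linearExtension p (barycenter s) = (s.1.card : ℝ)⁻¹ • ∑ v ∈ s.1, p v := by
  classical
  simp only [linearExtension, barycenter_apply, ite_smul, zero_smul, Finset.sum_ite_mem,
    Finset.univ_inter, Finset.smul_sum]

theorem linearExtension_single [DecidableEq K.Vertex] (x : K.Realization) :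
    linearExtension (fun v => (Pi.single v 1 : K.Vertex → ℝ)) x = x.1 :=
  (pi_eq_sum_univ' _).symm

end LinearExtension

variable (K) in
/-- The map `|K'| → |K|` which is linear on each simplex and sends each vertex of the subdivision
`K'` to the barycenter of the corresponding simplex. -/
noncomputable def subdivisionMap : C(K.subdivision.Realization, K.Realization) where
  toFun x :=
    ⟨⟨linearExtension (fun s : K.subdivision.Vertex => ⇑(barycenter (K := K) s).1) x,
      linearExtension_mem (convex_stdSimplex ℝ _) fun s _ => (barycenter (K := K) s).1.2⟩, by
    obtain ⟨c, hc, hx⟩ := exists_carrier x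
    obtain ⟨s, -, hs⟩ := exists_max_of_mem_subdivision hc
    refine ⟨s.1, s.2, fun v hv => ?_⟩
    by_contra hvs
    refine hv (linearExtension_mem (A := {y : K.Vertex → ℝ | y v = 0}) ?_ fun t ht => ?_)
    · exact (LinearMap.ker (LinearMap.proj v : (K.Vertex → ℝ) →ₗ[ℝ] ℝ)).convex
    · exact if_neg fun hvt => hvs (hs t (hx t ht) hvt)⟩
  continuous_toFun := by
    refine .subtype_mk (.subtype_mk (continuous_finsetSum _ fun s _ => ?_) _) _
    exact (continuous_coord s).smul continuous_const

theorem subdivisionMap_apply (x : K.subdivision.Realization) (v : K.Vertex) :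
    (K.subdivisionMap x).1 v = ∑ s : K.subdivision.Vertex, x.1 s * (barycenter (K := K) s).1 v :=
  Finset.sum_apply _ _ _

theorem linearExtension_subdivisionMap {E : Type*} [AddCommGroup E] [Module ℝ E]
    (p : K.Vertex → E) (x : K.subdivision.Realization) :
    linearExtension p (K.subdivisionMap x) =
      linearExtension (fun s : K.subdivision.Vertex => linearExtension p (barycenter s)) x := by
  simp only [linearExtension, subdivisionMap_apply, Finset.sum_smul, Finset.smul_sum, mul_smul]
  exact Finset.sum_comm

variable (K)

/-- The `n`-fold barycentric subdivision of `K`. -/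
noncomputable def iterSubdivision : ℕ → FinSimplicialComplex.{u}
  | 0 => K
  | n + 1 => (iterSubdivision n).subdivision

/-- The map `|K⁽ⁿ⁾| → |K|` of the `n`-fold barycentric subdivision, linear on each simplex. -/
noncomputable def iterSubdivisionMap : ∀ n, C((K.iterSubdivision n).Realization, K.Realization)
  | 0 => .id _
  | n + 1 => (iterSubdivisionMap n).comp (K.iterSubdivision n).subdivisionMap

variable {K}

/-! ### The mesh of iterated subdivisions -/

/-- `K` has dimension at most `d`. -/
def DimLE (K : FinSimplicialComplex.{u}) (d : ℕ) : Prop := ∀ s ∈ K.toComplex, s.card ≤ d + 1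

theorem dimLE_card_vertex (K : FinSimplicialComplex.{u}) : K.DimLE (Fintype.card K.Vertex) :=
  fun s _ => s.card_le_univ.trans (Nat.le_succ _)

theorem DimLE.subdivision {d : ℕ} (h : K.DimLE d) : K.subdivision.DimLE d := by
  intro (c : Finset K.Simplex) hc
  have card_injOn : Set.InjOn (fun s : K.Simplex => s.1.card) c := fun s hs t ht hst => by
    rcases hc.2.total hs ht with hle | hle
    · exact Subtype.ext (Finset.eq_of_subset_of_card_le hle hst.ge)
    · exact Subtype.ext (Finset.eq_of_subset_of_card_le hle hst.le).symm
  have card_mem : Set.MapsTo (fun s : K.Simplex => s.1.card) c (Finset.Icc 1 (d + 1)) :=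
    fun s _ => Finset.mem_coe.2 (Finset.mem_Icc.2 ⟨(nonempty_of_mem s.2).card_pos, h _ s.2⟩)
  simpa only [Nat.card_Icc, Nat.add_sub_cancel] using
    Finset.card_le_card_of_injOn _ card_mem card_injOn

theorem DimLE.iterSubdivision {d : ℕ} (h : K.DimLE d) : ∀ n, (K.iterSubdivision n).DimLE d
  | 0 => h
  | n + 1 => (DimLE.iterSubdivision h n).subdivision

section Mesh

variable {E : Type*} [SeminormedAddCommGroup E]

/-- The linear extension of `p` has mesh at most `r`: it maps any two vertices of a simplex to
points at distance at most `r`. -/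
def MeshLE (p : K.Vertex → E) (r : ℝ) : Prop :=
  ∀ s ∈ K.toComplex, ∀ v ∈ s, ∀ w ∈ s, dist (p v) (p w) ≤ r

theorem meshLE_diam_range (p : K.Vertex → E) : MeshLE p (Metric.diam (Set.range p)) :=
  fun _ _ v _ w _ => Metric.dist_le_diam_of_mem (Set.finite_range p).isBounded
    (Set.mem_range_self v) (Set.mem_range_self w)

variable [NormedSpace ℝ E] {p : K.Vertex → E} {r : ℝ}

theorem MeshLE.dist_linearExtension_le (h : MeshLE p r) {v : K.Vertex} {x : K.Realization}
    (hx : x ∈ openStar v) : dist (linearExtension p x) (p v) ≤ r := by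
  obtain ⟨s, hs, hxs⟩ := exists_carrier x
  exact linearExtension_mem (convex_closedBall (p v) r)
    fun w hw => h s hs w (hxs w hw) v (hxs v hx)

theorem MeshLE.dist_barycenter_le (h : MeshLE p r) {d : ℕ} (hd : K.DimLE d) {t : K.Simplex}
    {v : K.Vertex} (hv : v ∈ t.1) :
    dist (p v) (linearExtension p (barycenter t)) ≤ d / (d + 1) * r := by
  classical
  have card_pos : (0 : ℝ) < t.1.card := by exact_mod_cast (nonempty_of_mem t.2).card_pos
  have card_le : (t.1.card : ℝ) ≤ d + 1 := by exact_mod_cast hd t.1 t.2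
  have hr : 0 ≤ r := dist_nonneg.trans (h t.1 t.2 v hv v hv)
  have sub_eq : p v - linearExtension p (barycenter t) =
      (t.1.card : ℝ)⁻¹ • ∑ w ∈ t.1.erase v, (p v - p w) := by
    rw [Finset.sum_erase _ (sub_self _), Finset.sum_sub_distrib, Finset.sum_const,
      linearExtension_barycenter, smul_sub, ← Nat.cast_smul_eq_nsmul ℝ,
      inv_smul_smul₀ card_pos.ne']
  have norm_sum_le : ‖∑ w ∈ t.1.erase v, (p v - p w)‖ ≤ (t.1.card - 1) * r := by
    refine (norm_sum_le_of_le _ fun w hw => (dist_eq_norm (p v) (p w)).ge.trans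
      (h t.1 t.2 v hv w (Finset.mem_of_mem_erase hw))).trans_eq ?_
    rw [Finset.sum_const, nsmul_eq_mul, Finset.cast_card_erase_of_mem hv]
  calc dist (p v) (linearExtension p (barycenter t))
      ≤ (t.1.card : ℝ)⁻¹ * ((t.1.card - 1) * r) := by
        rw [dist_eq_norm, sub_eq, norm_smul, Real.norm_of_nonneg (by positivity)]
        gcongr
    _ = (1 - (t.1.card : ℝ)⁻¹) * r := by field_simp
    _ ≤ (1 - (d + 1 : ℝ)⁻¹) * r := by gcongr
    _ = d / (d + 1) * r := by field_simp; ring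

theorem MeshLE.subdivision (h : MeshLE p r) {d : ℕ} (hd : K.DimLE d) :
    MeshLE (fun s : K.subdivision.Vertex => linearExtension p (barycenter s))
      (d / (d + 1) * r) := by
  have dist_le {s t : K.Simplex} (hst : s ≤ t) :
      dist (linearExtension p (barycenter s)) (linearExtension p (barycenter t)) ≤
        d / (d + 1) * r :=
    linearExtension_mem (convex_closedBall _ _) fun v hv =>
      h.dist_barycenter_le hd (hst (barycenter_mem_openStar_iff.1 hv))
  intro c hc s hs t ht
  rcases hc.2.total hs ht with hst | hts
  · exact dist_le hst
  · exact (dist_comm _ _).trans_le (dist_le hts)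

theorem MeshLE.exists_iterSubdivision (h : MeshLE p r) {d : ℕ} (hd : K.DimLE d) (n : ℕ) :
    ∃ q : (K.iterSubdivision n).Vertex → E, MeshLE q ((d / (d + 1)) ^ n * r) ∧
      ∀ x, linearExtension p (K.iterSubdivisionMap n x) = linearExtension q x := by
  induction n with
  | zero => exact ⟨p, by rwa [pow_zero, one_mul], fun _ => rfl⟩
  | succ n ih =>
    obtain ⟨q, hq, hpq⟩ := ih
    refine ⟨_, ?_, fun x => (hpq _).trans (linearExtension_subdivisionMap q x)⟩
    rw [pow_succ', mul_assoc]
    exact hq.subdivision (hd.iterSubdivision n)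

end Mesh

open Filter Topology in
theorem eventually_dist_iterSubdivisionMap_lt (K : FinSimplicialComplex.{u}) {ε : ℝ} (hε : 0 < ε) :
    ∀ᶠ n in atTop, ∀ v, ∀ x ∈ openStar v, ∀ y ∈ openStar v,
      dist (K.iterSubdivisionMap n x) (K.iterSubdivisionMap n y) < ε := by
  classical
  let p : K.Vertex → K.Vertex → ℝ := fun v => Pi.single v 1
  let d := Fintype.card K.Vertex
  have mesh_tendsto :
      Tendsto (fun n => ((d : ℝ) / (d + 1)) ^ n * Metric.diam (Set.range p)) atTop (𝓝 0) := by
    rw [← zero_mul (Metric.diam (Set.range p))]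
    refine (tendsto_pow_atTop_nhds_zero_of_lt_one (by positivity) ?_).mul_const _
    exact (div_lt_one (by positivity)).2 (lt_add_one _)
  filter_upwards [mesh_tendsto.eventually_lt_const (half_pos hε)] with n hn v x hx y hy
  obtain ⟨q, hq, hpq⟩ := (meshLE_diam_range p).exists_iterSubdivision K.dimLE_card_vertex n
  calc dist (K.iterSubdivisionMap n x) (K.iterSubdivisionMap n y)
      = dist (linearExtension q x) (linearExtension q y) := by
        rw [← hpq, ← hpq, linearExtension_single, linearExtension_single]
        rfl
    _ ≤ dist (linearExtension q x) (q v) + dist (linearExtension q y) (q v) :=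
        dist_triangle_right _ _ _
    _ < ε / 2 + ε / 2 := add_lt_add ((hq.dist_linearExtension_le hx).trans_lt hn)
        ((hq.dist_linearExtension_le hy).trans_lt hn)
    _ = ε := add_halves ε

open Filter in
theorem eventually_iterSubdivisionMap_mapsTo {ι : Type*} {U : ι → Set K.Realization}
    (hU : ∀ i, IsOpen (U i)) (hcover : ∀ x, ∃ i, x ∈ U i) :
    ∀ᶠ n in atTop, ∀ v, ∃ i, Set.MapsTo (K.iterSubdivisionMap n) (openStar v) (U i) := by
  obtain ⟨δ, hδ, ball_subset⟩ := lebesgue_number_lemma_of_metric isCompact_univ hU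
    fun x _ => Set.mem_iUnion.2 (hcover x)
  filter_upwards [K.eventually_dist_iterSubdivisionMap_lt hδ] with n hn v
  let vertex : (K.iterSubdivision n).Realization :=
    barycenter ⟨{v}, (K.iterSubdivision n).toComplex.singleton_mem v⟩
  have hv : vertex ∈ openStar v := barycenter_mem_openStar_iff.2 (Finset.mem_singleton_self v)
  obtain ⟨i, hi⟩ := ball_subset (K.iterSubdivisionMap n vertex) trivial
  exact ⟨i, fun x hx => hi (hn v x hx vertex hv)⟩

end FinSimplicialComplex

/-! ### Simplicial approximation -/

open FinSimplicialComplex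

section Approximation

variable {K L M : FinSimplicialComplex.{u}}

/-- `ψ` is a simplicial approximation of `f`, expressed by the star condition. -/
def Approximates (ψ : SimplicialMap K L) (f : C(K.Realization, L.Realization)) : Prop :=
  ∀ v, Set.MapsTo f (openStar v) (openStar (ψ.toFun v))

namespace Approximates

theorem comp {ψ : SimplicialMap L M} {g : C(L.Realization, M.Realization)}
    {φ : SimplicialMap K L} {f : C(K.Realization, L.Realization)} (hg : Approximates ψ g)
    (hf : Approximates φ f) : Approximates (ψ.comp φ) (g.comp f) :=
  fun v => (hg _).comp (hf v)

theorem realization (φ : SimplicialMap K L) : Approximates φ φ.realization := by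
  classical
  intro v x hv
  change 0 < stdSimplex.map φ.toFun x.1 (φ.toFun v)
  rw [stdSimplex.map_coe, FunOnFinite.linearMap_apply_apply]
  exact Finset.sum_pos' (fun w _ => stdSimplex.zero_le x.1 w)
    ⟨v, Finset.mem_filter.2 ⟨Finset.mem_univ v, rfl⟩, hv⟩

theorem vertexMap (K : FinSimplicialComplex.{u}) : Approximates K.vertexMap K.subdivisionMap := by
  intro s x hs
  change 0 < (K.subdivisionMap x).1 (K.vertexMap.toFun s)
  rw [subdivisionMap_apply]
  exact Finset.sum_pos' (fun t _ => mul_nonneg (stdSimplex.zero_le _ _) (stdSimplex.zero_le _ _))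
    ⟨s, Finset.mem_univ s, mul_pos hs (barycenter_mem_openStar_iff.2 (vertexMap_mem s))⟩

theorem contiguous {φ ψ : SimplicialMap K L} {f : C(K.Realization, L.Realization)}
    (hφ : Approximates φ f) (hψ : Approximates ψ f) : φ.Contiguous ψ := by
  classical
  intro s hs
  refine mem_of_forall_mem_openStar (f (barycenter ⟨s, hs⟩))
    (((nonempty_of_mem hs).image _).mono Finset.subset_union_left) fun w hw => ?_
  rcases Finset.mem_union.1 hw with hw | hw <;> obtain ⟨v, hv, rfl⟩ := Finset.mem_image.1 hw
  · exact hφ v (barycenter_mem_openStar_iff.2 hv)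
  · exact hψ v (barycenter_mem_openStar_iff.2 hv)

end Approximates

/-- A vertex map satisfying the star condition with respect to `f`, as a simplicial map. -/
def SimplicialMap.ofMapsToOpenStar (f : C(K.Realization, L.Realization))
    (p : K.Vertex → L.Vertex) (hp : ∀ v, Set.MapsTo f (openStar v) (openStar (p v))) :
    SimplicialMap K L where
  toFun := p
  image_mem s hs := by
    classical
    refine mem_of_forall_mem_openStar (f (barycenter ⟨s, hs⟩)) ((nonempty_of_mem hs).image _) ?_
    exact Finset.forall_mem_image.2 fun v hv => hp v (barycenter_mem_openStar_iff.2 hv)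

open Filter in
theorem eventually_exists_common_approximation {f g : C(K.Realization, L.Realization)}
    (hfg : ∀ x, ∃ w, f x ∈ openStar w ∧ g x ∈ openStar w) :
    ∀ᶠ n in atTop, ∃ ψ : SimplicialMap (K.iterSubdivision n) L,
      Approximates ψ (f.comp (K.iterSubdivisionMap n)) ∧
        Approximates ψ (g.comp (K.iterSubdivisionMap n)) := by
  have isOpen_inter (w : L.Vertex) : IsOpen (f ⁻¹' openStar w ∩ g ⁻¹' openStar w) :=
    ((isOpen_openStar w).preimage f.continuous).inter ((isOpen_openStar w).preimage g.continuous)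
  filter_upwards [eventually_iterSubdivisionMap_mapsTo isOpen_inter hfg] with n hn
  choose p hp using hn
  exact ⟨.ofMapsToOpenStar (f.comp _) p fun v x hx => (hp v hx).1,
    fun v x hx => (hp v hx).1, fun v x hx => (hp v hx).2⟩

open Filter in
theorem eventually_exists_approximation (f : C(K.Realization, L.Realization)) :
    ∀ᶠ n in atTop, ∃ ψ : SimplicialMap (K.iterSubdivision n) L,
      Approximates ψ (f.comp (K.iterSubdivisionMap n)) :=
  (eventually_exists_common_approximation (f := f) (g := f) fun x =>
    (exists_mem_openStar (f x)).imp fun _ hw => ⟨hw, hw⟩).mono fun _ h => h.imp fun _ => And.left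

open Topology in
theorem eventually_exists_mem_openStar (f : C(K.Realization, L.Realization)) :
    ∀ᶠ g in 𝓝 f, ∀ x, ∃ w, f x ∈ openStar w ∧ g x ∈ openStar w := by
  obtain ⟨δ, hδ, ball_subset⟩ := lebesgue_number_lemma_of_metric
    (isCompact_univ (X := L.Realization)) isOpen_openStar
    fun y _ => Set.mem_iUnion.2 (exists_mem_openStar y)
  filter_upwards [Metric.ball_mem_nhds f hδ] with g hg x
  obtain ⟨w, hw⟩ := ball_subset (f x) trivial
  exact ⟨w, hw (Metric.mem_ball_self hδ), hw ((ContinuousMap.dist_apply_le_dist x).trans_lt hg)⟩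

/-! ### Maps of realizations with simplicial approximations in `𝒟̄` -/

theorem Approximates.dbar_congr {φ ψ : SimplicialMap K L} {f : C(K.Realization, L.Realization)}
    (hφ : Approximates φ f) (hψ : Approximates ψ f) : DBar φ.faceMap ↔ DBar ψ.faceMap :=
  ⟨fun h => h.of_homotopic (hφ.contiguous hψ).faceMap_homotopic,
    fun h => h.of_homotopic (hψ.contiguous hφ).faceMap_homotopic⟩

theorem Approximates.exists_of_le {f : C(K.Realization, L.Realization)} {m n : ℕ} (hmn : m ≤ n)
    {ψ : SimplicialMap (K.iterSubdivision m) L}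
    (hψ : Approximates ψ (f.comp (K.iterSubdivisionMap m))) :
    ∃ χ : SimplicialMap (K.iterSubdivision n) L,
      Approximates χ (f.comp (K.iterSubdivisionMap n)) ∧
        (DBar χ.faceMap ↔ DBar ψ.faceMap) := by
  induction n, hmn using Nat.le_induction with
  | base => exact ⟨ψ, hψ, .rfl⟩
  | succ n _ ih =>
    obtain ⟨χ, hχ, χ_iff⟩ := ih
    exact ⟨χ.comp (K.iterSubdivision n).vertexMap, hχ.comp (.vertexMap _),
      (SimplicialMap.dbar_comp_iff_left (K.iterSubdivision n).dbar_vertexMap).trans χ_iff⟩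

/-- Some simplicial approximation of `f`, defined on an iterated subdivision of `K`, induces a map
of finite spaces in `𝒟̄`. By `HasDBarApprox.dbar` all simplicial approximations of `f` then do. -/
def HasDBarApprox (f : C(K.Realization, L.Realization)) : Prop :=
  ∃ (n : ℕ) (ψ : SimplicialMap (K.iterSubdivision n) L),
    Approximates ψ (f.comp (K.iterSubdivisionMap n)) ∧ DBar ψ.faceMap

namespace HasDBarApprox

theorem id (K : FinSimplicialComplex.{u}) : HasDBarApprox (.id K.Realization) :=
  ⟨1, K.vertexMap, .vertexMap K, K.dbar_vertexMap⟩

theorem dbar {f : C(K.Realization, L.Realization)} (hf : HasDBarApprox f) {n : ℕ}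
    {χ : SimplicialMap (K.iterSubdivision n) L}
    (hχ : Approximates χ (f.comp (K.iterSubdivisionMap n))) : DBar χ.faceMap := by
  obtain ⟨m, ψ, hψ, ψ_dbar⟩ := hf
  obtain ⟨ψ', hψ', ψ'_iff⟩ := hψ.exists_of_le (le_max_left m n)
  obtain ⟨χ', hχ', χ'_iff⟩ := hχ.exists_of_le (le_max_right m n)
  exact χ'_iff.1 ((hψ'.dbar_congr hχ').1 (ψ'_iff.2 ψ_dbar))

theorem congr_of_openStar {f g : C(K.Realization, L.Realization)}
    (hfg : ∀ x, ∃ w, f x ∈ openStar w ∧ g x ∈ openStar w) :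
    HasDBarApprox f ↔ HasDBarApprox g := by
  obtain ⟨n, ψ, hfψ, hgψ⟩ := (eventually_exists_common_approximation hfg).exists
  exact ⟨fun hf => ⟨n, ψ, hgψ, hf.dbar hfψ⟩, fun hg => ⟨n, ψ, hfψ, hg.dbar hgψ⟩⟩

theorem congr_of_homotopic {f g : C(K.Realization, L.Realization)} (h : f.Homotopic g) :
    HasDBarApprox f ↔ HasDBarApprox g := by
  have isLocallyConstant :
      IsLocallyConstant (HasDBarApprox : C(K.Realization, L.Realization) → Prop) :=
    (IsLocallyConstant.iff_eventually_eq _).2 fun f =>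
      (eventually_exists_mem_openStar f).mono fun _ hg => propext (congr_of_openStar hg).symm
  exact (eq_of_homotopic_of_isLocallyConstant isLocallyConstant h).to_iff

theorem realization_comp {f : C(K.Realization, L.Realization)} (hf : HasDBarApprox f)
    {φ : SimplicialMap L M} (hφ : DBar φ.faceMap) : HasDBarApprox (φ.realization.comp f) := by
  obtain ⟨n, ψ, hψ, ψ_dbar⟩ := hf
  refine ⟨n, φ.comp ψ, ?_, (SimplicialMap.dbar_comp_iff_left ψ_dbar).2 hφ⟩
  rw [ContinuousMap.comp_assoc]
  exact (Approximates.realization φ).comp hψ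

theorem of_realization_comp {f : C(K.Realization, L.Realization)} {φ : SimplicialMap L M}
    (hφ : DBar φ.faceMap) (h : HasDBarApprox (φ.realization.comp f)) : HasDBarApprox f := by
  obtain ⟨n, ψ, hψ⟩ := (eventually_exists_approximation f).exists
  have comp_dbar : DBar (φ.comp ψ).faceMap := h.dbar <| by
    rw [ContinuousMap.comp_assoc]
    exact (Approximates.realization φ).comp hψ
  exact ⟨n, ψ, hψ, (SimplicialMap.dbar_comp_iff_right hφ).1 comp_dbar⟩

theorem homotopyInverse_comp {f : C(K.Realization, L.Realization)} (hf : HasDBarApprox f)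
    {φ : SimplicialMap M L} (hφ : DBar φ.faceMap) {g : C(L.Realization, M.Realization)}
    (hg : IsHomotopyInverse g φ.realization) : HasDBarApprox (g.comp f) := by
  have comp_homotopic : (φ.realization.comp (g.comp f)).Homotopic f := hg.2.comp (.refl f)
  exact of_realization_comp hφ ((congr_of_homotopic comp_homotopic).2 hf)

end HasDBarApprox

end Approximation

theorem hasDBarApprox_chainComp (n : ℕ) (K : Fin (n + 1) → FinSimplicialComplex.{u})
    (f : ∀ i : Fin n, C((K i.castSucc).Realization, (K i.succ).Realization))
    (hf : ∀ i : Fin n,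
      (∃ φ : SimplicialMap (K i.castSucc) (K i.succ),
        DBar φ.faceMap ∧ f i = φ.realization) ∨
      (∃ φ : SimplicialMap (K i.succ) (K i.castSucc),
        DBar φ.faceMap ∧ IsHomotopyInverse (f i) φ.realization)) :
    HasDBarApprox (chainComp n (fun i => (K i).Realization) f) := by
  induction n with
  | zero => exact .id (K 0)
  | succ n ih =>
    have previous := ih (fun i => K i.castSucc) (fun i => f i.castSucc) fun i => hf i.castSucc
    rw [chainComp]
    rcases hf (Fin.last n) with ⟨φ, hφ, f_eq⟩ | ⟨φ, hφ, f_inverse⟩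
    · rw [f_eq]
      exact previous.realization_comp hφ
    · exact previous.homotopyInverse_comp hφ f_inverse

theorem mainTheorem3 (n : ℕ) (K : Fin (n + 1) → FinSimplicialComplex.{u})
    (f : ∀ i : Fin n, C((K i.castSucc).Realization, (K i.succ).Realization))
    (hf : ∀ i : Fin n,
      (∃ φ : SimplicialMap (K i.castSucc) (K i.succ),
        DBar φ.faceMap ∧ f i = φ.realization) ∨
      (∃ φ : SimplicialMap (K i.succ) (K i.castSucc),
        DBar φ.faceMap ∧ IsHomotopyInverse (f i) φ.realization))
    (φ : SimplicialMap (K 0) (K (Fin.last n)))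
    (hφ : φ.realization.Homotopic (chainComp n (fun i => (K i).Realization) f)) :
    DBar φ.faceMap := by
  have hasDBarApprox : HasDBarApprox φ.realization :=
    (HasDBarApprox.congr_of_homotopic hφ).2 (hasDBarApprox_chainComp n K f hf)
  exact hasDBarApprox.dbar (n := 0) (.realization φ)
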